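/- Every irrational real number $x$ has a unique simple continued fraction expansion $x=[a_0(x);a_1(x),a_2(x),\ldots]$ with $a_0(x)\in\mathbb{Z}$ and $a_n(x)$ a positive integer for all $n\ge 1$. Put $$B(x):=\limsup_{n\to\infty}a_n(x)\in\{1,2,3,\ldots\}\cup\{\infty\}.$$ Theorem. For every irrational real number $\alpha$, $$\sup_{k\ge 0}B(2^k\alpha)\ge 5.$$ -/

import Mathlib

open Filter

/-- The `n`-th partial quotient `a_n(x)` of the simple continued fraction expansion
`x = [a_0; a_1, a_2, …]` of a real number, as computed by `GenContFract.of`.  The default value `0`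
only occurs after a terminating expansion, hence never for irrational `x`. -/
noncomputable def partialQuotient (x : ℝ) : ℕ → ℝ
  | 0 => (GenContFract.of x).h
  | n + 1 => ((GenContFract.of x).partDens.get? n).getD 0

/-- `B(x) = limsup_{n → ∞} a_n(x)`, in the extended reals; it is `⊤` exactly when the partial
quotients are unbounded. -/
noncomputable def limsupPartialQuotients (x : ℝ) : EReal :=
  limsup (fun n : ℕ => ((partialQuotient x n : ℝ) : EReal)) atTop

/-!
The Farey expansion of a positive irrational number is the word in two letters whose runs of equal
letters have the partial quotients as lengths. Partial quotients that are eventually at most `4`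
mean that from some point on no five consecutive letters agree (`exists_noLongRun`).

Multiplication by `2` acts on Farey expansions through a transducer with four states
(`related_step`). Suppose that `2 ^ k * α` eventually has all partial quotients at most `4`, for
every `k`. A cascade of five transducers then reads a tail of `α`, and no level shows a run of
length five. There are only finitely many starting states, and a finite search
(`search_towers`) shows that the word read is, after at most three letters, a factor of one periodic
word, that of `(3 + √17) / 4`. The number `17` is a quadratic residue modulo every power of `2`;
because of this the periodic word does survive in suitable states for any number of doublings, and
the search alone cannot end the proof.

Instead, the conclusion is applied to `2 ^ k * α` for every `k`. Each of these numbers has the tail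
of a root of `2 z² - 3 z - 1` (`root_of_periodic`), hence is itself a root of an integral quadratic
polynomial of discriminant `17`. The discriminants of the polynomials belonging to `2 ^ k * α`
cannot stay constant, by divisibility of the leading coefficient (`not_forall_isRootDisc17`).
-/

namespace FareyDoubling

/-! ### The Farey expansion -/

/-- The slow continued fraction map. It subtracts `1` from a number above `1`, and below `1` it does
the same to the reciprocal. -/
noncomputable def fareyMap (x : ℝ) : ℝ := if 1 < x then x - 1 else x / (1 - x)

/-- The branch of `fareyMap` used at `x`: `true` above `1`, `false` below. -/
noncomputable def letter (x : ℝ) : Bool := decide (1 < x)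

/-- The first `n` letters of the Farey expansion of `x`. Its maximal runs of equal letters have the
partial quotients of `x` as lengths. -/
noncomputable def word : ℝ → ℕ → List Bool
  | _, 0 => []
  | x, n + 1 => letter x :: word (fareyMap x) n

/-- Positive irrational numbers, on which the Farey expansion never stops. -/
def PosIrrational (x : ℝ) : Prop := 0 < x ∧ Irrational x

theorem letter_eq_true {x : ℝ} (h : 1 < x) : letter x = true := by simp [letter, h]

theorem letter_eq_false {x : ℝ} (h : x < 1) : letter x = false := by simp [letter, h.le]

theorem fareyMap_of_one_lt {x : ℝ} (h : 1 < x) : fareyMap x = x - 1 := by simp [fareyMap, h]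

theorem fareyMap_of_lt_one {x : ℝ} (h : x < 1) : fareyMap x = x / (1 - x) := by
  simp [fareyMap, h.not_gt]

theorem PosIrrational.lt_or_lt {x : ℝ} (hx : PosIrrational x) : 1 < x ∨ x < 1 :=
  (lt_or_gt_of_ne hx.2.ne_one).symm

theorem PosIrrational.inv {x : ℝ} (hx : PosIrrational x) : PosIrrational x⁻¹ :=
  ⟨inv_pos.2 hx.1, irrational_inv_iff.2 hx.2⟩

theorem PosIrrational.sub_one {x : ℝ} (hx : PosIrrational x) (h : 1 < x) :
    PosIrrational (x - 1) := ⟨by linarith, by simpa using hx.2.sub_intCast 1⟩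

theorem fareyMap_inv {x : ℝ} (hx : PosIrrational x) : fareyMap x⁻¹ = (fareyMap x)⁻¹ := by
  have h0 := hx.1
  rcases hx.lt_or_lt with h | h
  · rw [fareyMap_of_one_lt h, fareyMap_of_lt_one (inv_lt_one_of_one_lt₀ h)]
    have : x - 1 ≠ 0 := by linarith
    field_simp
  · rw [fareyMap_of_lt_one h, fareyMap_of_one_lt ((one_lt_inv₀ h0).2 h)]
    have : 1 - x ≠ 0 := by linarith
    field_simp

theorem PosIrrational.fareyMap {x : ℝ} (hx : PosIrrational x) : PosIrrational (fareyMap x) := by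
  rcases hx.lt_or_lt with h | h
  · rw [fareyMap_of_one_lt h]; exact hx.sub_one h
  · have := fareyMap_inv hx.inv
    rw [inv_inv] at this
    rw [this, fareyMap_of_one_lt ((one_lt_inv₀ hx.1).2 h)]
    exact (hx.inv.sub_one ((one_lt_inv₀ hx.1).2 h)).inv

theorem letter_inv {x : ℝ} (hx : PosIrrational x) : letter x⁻¹ = !letter x := by
  rcases hx.lt_or_lt with h | h
  · rw [letter_eq_true h, letter_eq_false (inv_lt_one_of_one_lt₀ h)]; rfl
  · rw [letter_eq_false h, letter_eq_true ((one_lt_inv₀ hx.1).2 h)]; rfl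

theorem PosIrrational.iterate {x : ℝ} (hx : PosIrrational x) (n : ℕ) :
    PosIrrational (FareyDoubling.fareyMap^[n] x) := by
  induction n with
  | zero => exact hx
  | succ n ih => rw [Function.iterate_succ_apply']; exact ih.fareyMap

theorem iterate_fareyMap_inv {x : ℝ} (hx : PosIrrational x) (n : ℕ) :
    fareyMap^[n] x⁻¹ = (fareyMap^[n] x)⁻¹ := by
  induction n with
  | zero => rfl
  | succ n ih =>
    rw [Function.iterate_succ_apply', ih, fareyMap_inv (hx.iterate n),
      Function.iterate_succ_apply']

@[simp] theorem length_word (x : ℝ) (n : ℕ) : (word x n).length = n := by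
  induction n generalizing x with
  | zero => rfl
  | succ n ih => simp [word, ih]

theorem word_add (x : ℝ) (m n : ℕ) : word x (m + n) = word x m ++ word (fareyMap^[m] x) n := by
  induction m generalizing x with
  | zero => simp [word]
  | succ m ih => rw [Nat.add_right_comm]; simp [word, ih]

/-- No five consecutive letters of the Farey expansion of `x` agree. -/
def NoLongRun (x : ℝ) : Prop :=
  ∀ n, ∃ i < 5, letter (fareyMap^[n + i] x) ≠ letter (fareyMap^[n] x)

theorem NoLongRun.iterate {x : ℝ} (hx : NoLongRun x) (m : ℕ) : NoLongRun (fareyMap^[m] x) := by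
  intro n
  obtain ⟨i, hi, h⟩ := hx (n + m)
  refine ⟨i, hi, ?_⟩
  rw [← Function.iterate_add_apply, ← Function.iterate_add_apply]
  rwa [Nat.add_right_comm]

/-! ### The doubling transducer -/

/-- The states of the finite transducer that turns the Farey expansion of `x` into that of `2 * x`.
In the states `double` and `halve` the number being written is twice, respectively half, the number
being read; `doubleL` is `double` after reading one `false`, and `halveR` is `halve` after reading
one `true`, with nothing written yet. The exact relations are in `Related`. -/
inductive State
  | double | halve | doubleL | halveR

open State

/-- One step of the doubling transducer: the new state and the letters written. -/
def step : State → Bool → State × List Bool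
  | double, true => (double, [true, true])
  | double, false => (doubleL, [])
  | halve, true => (halveR, [])
  | halve, false => (halve, [false, false])
  | doubleL, true => (halve, [true, false])
  | doubleL, false => (double, [false])
  | halveR, true => (halve, [true])
  | halveR, false => (double, [false, true])

/-- The doubling transducer on a word: the final state and the word written. -/
def run : State → List Bool → State × List Bool
  | s, [] => (s, [])
  | s, b :: w => ((run (step s b).1 w).1, (step s b).2 ++ (run (step s b).1 w).2)

/-- The pairs of states that two consecutive transducers can have at the same time when both start
in `double`. The four excluded pairs are those in which the second doubling undoes the first. -/
def compatible : State → State → Bool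
  | double, halve => false
  | halve, double => false
  | doubleL, halve => false
  | halveR, double => false
  | _, _ => true

/-- The states of a cascade of transducers, each reading what the one before it writes, after the
first has read a given word. -/
def runTower : List State → List Bool → List State
  | [], _ => []
  | s :: t, w => (run s w).1 :: runTower t (run s w).2

/-- The relation between the number `x` still to be read and the number `y` still to be written. -/
def Related : State → ℝ → ℝ → Prop
  | double, x, y => y = 2 * x
  | halve, x, y => y = x / 2
  | doubleL, x, y => y = 2 * x / (1 + x)
  | halveR, x, y => y = (1 + x) / 2

theorem Related.posIrrational {s : State} {x y : ℝ} (h : Related s x y) (hx : PosIrrational x) :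
    PosIrrational y := by
  have h0 := hx.1
  cases s <;> simp only [Related] at h <;> subst h
  · exact ⟨by positivity, by simpa using hx.2.natCast_mul (m := 2) two_ne_zero⟩
  · exact ⟨by positivity, by simpa using hx.2.div_natCast (m := 2) two_ne_zero⟩
  · refine ⟨by positivity, ?_⟩
    have : (2 * x / (1 + x))⁻¹ = (1 + x⁻¹) / 2 := by field_simp; ring
    rw [← irrational_inv_iff, this]
    simpa using ((irrational_inv_iff.2 hx.2).natCast_add 1).div_natCast (m := 2) two_ne_zero
  · exact ⟨by positivity, by
      simpa using (hx.2.natCast_add 1).div_natCast (m := 2) two_ne_zero⟩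

/-- The transducer is correct: it writes the Farey expansion of `y` while reading that of `x`. -/
theorem related_step {s : State} {x y : ℝ} (h : Related s x y) (hx : PosIrrational x) :
    (step s (letter x)).2 = word y (step s (letter x)).2.length ∧
      Related (step s (letter x)).1 (fareyMap x)
        (fareyMap^[(step s (letter x)).2.length] y) := by
  have h0 := hx.1
  rcases hx.lt_or_lt with h1 | h1
  · rw [letter_eq_true h1, fareyMap_of_one_lt h1]
    cases s <;> simp only [Related] at h <;> subst h <;> simp only [step, word, List.length,
      Function.iterate_succ_apply, Function.iterate_zero_apply, Related]
    · have e1 : 1 < 2 * x := by linarith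
      have e2 : 1 < 2 * x - 1 := by linarith
      rw [fareyMap_of_one_lt e1, fareyMap_of_one_lt e2, letter_eq_true e1, letter_eq_true e2]
      exact ⟨rfl, by ring⟩
    · exact ⟨trivial, by ring⟩
    · have e1 : 1 < 2 * x / (1 + x) := by rw [lt_div_iff₀ (by linarith)]; linarith
      have e2 : 2 * x / (1 + x) - 1 < 1 := by
        rw [sub_lt_iff_lt_add, div_lt_iff₀ (by linarith)]; linarith
      rw [fareyMap_of_one_lt e1, fareyMap_of_lt_one e2, letter_eq_true e1, letter_eq_false e2]
      refine ⟨rfl, ?_⟩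
      have : 1 - (2 * x / (1 + x) - 1) = 2 / (1 + x) := by field_simp; ring
      rw [this]; field_simp; ring
    · have e1 : 1 < (1 + x) / 2 := by linarith
      rw [fareyMap_of_one_lt e1, letter_eq_true e1]
      exact ⟨rfl, by ring⟩
  · rw [letter_eq_false h1, fareyMap_of_lt_one h1]
    have hs : 1 - x ≠ 0 := by linarith
    cases s <;> simp only [Related] at h <;> subst h <;> simp only [step, word, List.length,
      Function.iterate_succ_apply, Function.iterate_zero_apply, Related]
    · refine ⟨trivial, ?_⟩
      have : 1 + x / (1 - x) = 1 / (1 - x) := by field_simp; ring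
      rw [this]; field_simp
    · have e1 : x / 2 < 1 := by linarith
      have e3 : x / 2 / (1 - x / 2) = x / (2 - x) := by
        have : 2 - x ≠ 0 := by linarith
        field_simp
      have e2 : x / (2 - x) < 1 := by rw [div_lt_one (by linarith)]; linarith
      rw [fareyMap_of_lt_one e1, letter_eq_false e1, e3, fareyMap_of_lt_one e2, letter_eq_false e2]
      refine ⟨rfl, ?_⟩
      have : 2 - x ≠ 0 := by linarith
      have : 1 - x / (2 - x) = 2 * (1 - x) / (2 - x) := by field_simp; ring
      rw [this]; field_simp
    · have e1 : 2 * x / (1 + x) < 1 := by rw [div_lt_one (by linarith)]; linarith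
      rw [fareyMap_of_lt_one e1, letter_eq_false e1]
      refine ⟨rfl, ?_⟩
      have : 1 - 2 * x / (1 + x) = (1 - x) / (1 + x) := by field_simp; ring
      rw [this]; field_simp
    · have e1 : (1 + x) / 2 < 1 := by linarith
      have e3 : (1 + x) / 2 / (1 - (1 + x) / 2) = (1 + x) / (1 - x) := by
        have : 1 - (1 + x) / 2 = (1 - x) / 2 := by ring
        rw [this]; field_simp
      have e2 : 1 < (1 + x) / (1 - x) := by rw [lt_div_iff₀ (by linarith)]; linarith
      rw [fareyMap_of_lt_one e1, letter_eq_false e1, e3, fareyMap_of_one_lt e2, letter_eq_true e2]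
      refine ⟨rfl, ?_⟩
      field_simp; ring

theorem related_run {s : State} {x y : ℝ} (h : Related s x y) (hx : PosIrrational x) (m : ℕ) :
    (run s (word x m)).2 = word y (run s (word x m)).2.length ∧
      Related (run s (word x m)).1 (fareyMap^[m] x)
        (fareyMap^[(run s (word x m)).2.length] y) := by
  induction m generalizing s x y with
  | zero => exact ⟨rfl, h⟩
  | succ m ih =>
    obtain ⟨h1, h2⟩ := related_step h hx
    obtain ⟨h3, h4⟩ := ih h2 hx.fareyMap
    simp only [word, run, List.length_append, Function.iterate_succ_apply]
    refine ⟨?_, ?_⟩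
    · rw [word_add, ← h1, ← h3]
    · rw [Nat.add_comm, Function.iterate_add_apply]
      exact h4

/-- The number of letters read since the transducer last wrote. -/
def pending : State → ℕ
  | double | halve => 0
  | doubleL | halveR => 1

theorem length_run (s : State) (w : List Bool) :
    w.length + pending s ≤ 2 * (run s w).2.length + pending (run s w).1 := by
  induction w generalizing s with
  | nil => simp [run]
  | cons b w ih =>
    have := ih (step s b).1
    have h : 1 + pending s ≤ 2 * (step s b).2.length + pending (step s b).1 := by
      cases s <;> cases b <;> simp [step, pending]
    simp only [run, List.length_append, List.length_cons]
    omega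

theorem le_length_run (s : State) (w : List Bool) : w.length ≤ 2 * (run s w).2.length + 1 := by
  have h := length_run s w
  have : pending (run s w).1 ≤ 1 := by cases (run s w).1 <;> simp [pending]
  omega

theorem run_append (s : State) (v w : List Bool) :
    run s (v ++ w) = ((run (run s v).1 w).1, (run s v).2 ++ (run (run s v).1 w).2) := by
  induction v generalizing s with
  | nil => rfl
  | cons b v ih => simp [run, ih]

theorem compatible_step {s t : State} (h : compatible s t = true) (b : Bool) :
    compatible (step s b).1 (run t (step s b).2).1 = true := by
  cases s <;> cases t <;> cases b <;> first | rfl | exact absurd h (by decide)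

theorem compatible_run {s t : State} (h : compatible s t = true) (w : List Bool) :
    compatible (run s w).1 (run t (run s w).2).1 = true := by
  induction w generalizing s t with
  | nil => exact h
  | cons b w ih =>
    simp only [run, run_append]
    exact ih (compatible_step h b)

theorem isChain_runTower {t : List State} (h : t.IsChain (compatible · ·)) (w : List Bool) :
    (runTower t w).IsChain (compatible · ·) := by
  induction t generalizing w with
  | nil => simp [runTower]
  | cons s t ih =>
    cases t with
    | nil => simp [runTower]
    | cons u t =>
      rw [List.isChain_cons_cons] at h
      have := ih h.2 (run s w).2
      simp only [runTower] at this ⊢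
      exact List.isChain_cons_cons.2 ⟨compatible_run h.1 w, this⟩

@[simp] theorem length_runTower (t : List State) (w : List Bool) :
    (runTower t w).length = t.length := by
  induction t generalizing w with
  | nil => rfl
  | cons s t ih => simp [runTower, ih]

/-- `P` holds for `x` and for all the numbers written by a cascade of transducers that reads `x`. -/
def Tower (P : ℝ → Prop) : List State → ℝ → Prop
  | [], x => P x
  | s :: t, x => P x ∧ ∃ y, Related s x y ∧ Tower P t y

theorem Tower.top {P : ℝ → Prop} {t : List State} {x : ℝ} (h : Tower P t x) : P x := by
  cases t with
  | nil => exact h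
  | cons s t => exact h.1

/-- Conditions on the tails at the various levels hold at the same time from some point on, since
each transducer writes at least one letter for any two it reads. -/
theorem tower_eventually {t : List State} {x : ℝ} (hx : PosIrrational x)
    (h : Tower (fun z => ∃ n, NoLongRun (fareyMap^[n] z)) t x) :
    ∃ m, ∀ n ≥ m, Tower NoLongRun (runTower t (word x n)) (fareyMap^[n] x) := by
  obtain ⟨m₀, hm₀⟩ := h.top
  have key : ∀ n ≥ m₀, NoLongRun (fareyMap^[n] x) := by
    intro n hn
    obtain ⟨k, rfl⟩ := Nat.exists_eq_add_of_le' hn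
    rw [Function.iterate_add_apply]
    exact hm₀.iterate k
  induction t generalizing x m₀ with
  | nil => exact ⟨m₀, key⟩
  | cons s t ih =>
    obtain ⟨-, y, hy, hty⟩ := h
    have hyp := hy.posIrrational hx
    obtain ⟨m₁, hm₁⟩ := hty.top
    obtain ⟨m, hm⟩ := ih hyp hty m₁ hm₁ (by
      intro n hn
      obtain ⟨k, rfl⟩ := Nat.exists_eq_add_of_le' hn
      rw [Function.iterate_add_apply]
      exact hm₁.iterate k)
    -- Once `2 * m + 1` letters are read, at least `m` are written.
    refine ⟨max m₀ (2 * m + 1), fun n hn => ?_⟩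
    obtain ⟨h1, h2⟩ := related_run hy hx n
    refine ⟨key n (le_trans (le_max_left _ _) hn), _, h2, ?_⟩
    have hl := le_length_run s (word x n)
    rw [length_word] at hl
    have := le_trans (le_max_right m₀ (2 * m + 1)) hn
    have := hm (run s (word x n)).2.length (by omega)
    rwa [← h1] at this

/-! ### The search for words without long runs -/

/-- The current run of equal letters of a word: the letter and the length read so far. -/
abbrev Run := Bool × ℕ

/-- Reading one more letter, which fails when it completes a run of length five. -/
def bump (r : Run) (b : Bool) : Option Run :=
  if b = r.1 then (if r.2 = 4 then none else some (b, r.2 + 1)) else some (b, 1)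

/-- `bump` along a word. -/
def bumpWord : Run → List Bool → Option Run
  | r, [] => some r
  | r, b :: w => match bump r b with
    | none => none
    | some r' => bumpWord r' w

/-- Sends a word through a cascade of transducers and keeps track of the run at every level; fails
as soon as a run of length five shows up at some level. -/
def feed : Run → List (State × Run) → List Bool → Option (Run × List (State × Run))
  | r, l, w => match bumpWord r w with
    | none => none
    | some r' => match l with
      | [] => some (r', [])
      | (s, q) :: t => match feed q t (run s w).2 with
        | none => none
        | some (q', t') => some (r', ((run s w).1, q') :: t')
  termination_by structural _ l => l

/-- The period of the Farey expansion of `(3 + √17) / 4`. -/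
def period : List Bool :=
  [true, false, true, true, true, false, true, false, false, false]

/-- The ten factors of length five of the periodic word with period `period`, in the order in which
they occur. -/
def cycleFactors : List (List Bool) :=
  (List.range 10).map fun p =>
    ((period ++ period).drop p).take 5

/-- Depth-first search over the words that a cascade in a given configuration can read without
producing a run of length five. The list is the word read so far, and `true` is returned when every
branch either dies or has a member of `cycleFactors` at the positions `3` to `7`. Letters before
position `3` still feel that the runs in progress at the start are unknown. -/
def search : ℕ → List Bool → Run → List (State × Run) → Bool
  | 0, _, _, _ => false
  | n + 1, w, r, l =>
    (w.length == 8 && cycleFactors.contains (w.drop 3)) ||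
    ((match feed r l [true] with
      | none => true
      | some (r', l') => search n (w ++ [true]) r' l') &&
     (match feed r l [false] with
      | none => true
      | some (r', l') => search n (w ++ [false]) r' l'))

/-- All lists of `n` states in which consecutive states are `compatible`. -/
def towers : ℕ → List (List State)
  | 0 => [[]]
  | n + 1 => [double, halve, doubleL, halveR].flatMap fun s =>
    ((towers n).filter fun t => match t with
      | [] => true
      | u :: _ => compatible s u).map (s :: ·)

/-- The finite computation: whatever the states of a cascade of five doublings, if the number read
and its five doublings have no run of length five, then the letters at the positions `3` to `7` form
a factor of the periodic word. -/
theorem search_towers : ∀ t ∈ towers 5,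
    search 40 [] (true, 0) (t.map fun s => (s, (true, 0))) = true := by
  decide +kernel

theorem mem_towers {t : List State} (h : t.IsChain (compatible · ·)) : t ∈ towers t.length := by
  induction t with
  | nil => simp [towers]
  | cons s t ih =>
    simp only [towers, List.length_cons, List.mem_flatMap, List.mem_map, List.mem_filter]
    refine ⟨s, by cases s <;> simp, t, ⟨ih h.tail, ?_⟩, rfl⟩
    cases t with
    | nil => rfl
    | cons u t => exact (List.isChain_cons_cons.1 h).1

/-- `x` is reached along the run `r` from a number without long runs. The run need
not be maximal. -/
def HasRun (r : Run) (x : ℝ) : Prop :=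
  ∃ x₀, NoLongRun x₀ ∧ fareyMap^[r.2] x₀ = x ∧ ∀ i < r.2, letter (fareyMap^[i] x₀) = r.1

theorem HasRun.bump {r : Run} {x : ℝ} (h : HasRun r x) (hr : r.2 ≤ 4) :
    ∃ r', bump r (letter x) = some r' ∧ r'.2 ≤ 4 ∧ HasRun r' (fareyMap x) := by
  obtain ⟨x₀, h0, rfl, h2⟩ := h
  obtain ⟨c, n⟩ := r
  dsimp only at *
  unfold FareyDoubling.bump
  have next : letter (fareyMap^[n] x₀) = c → ∀ i < n + 1, letter (fareyMap^[i] x₀) = c := by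
    intro hc i hi
    rcases Nat.lt_succ_iff_lt_or_eq.1 hi with h | rfl
    · exact h2 i h
    · exact hc
  split_ifs with h h4
  · exfalso
    dsimp only at h h4
    subst h4
    obtain ⟨i, hi, hne⟩ := h0 0
    refine hne ?_
    rw [Nat.zero_add, next h i hi, next h 0 (by norm_num)]
  · dsimp only at h h4
    refine ⟨_, rfl, by dsimp only; omega, x₀, h0, ?_, ?_⟩
    · exact Function.iterate_succ_apply' _ _ _
    · dsimp only; rw [h]; exact next h
  · refine ⟨_, rfl, by norm_num, fareyMap^[n] x₀, h0.iterate n, rfl, ?_⟩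
    intro i hi
    dsimp only at hi
    obtain rfl : i = 0 := by omega
    rfl

theorem HasRun.bumpWord {r : Run} {x : ℝ} (h : HasRun r x) (hr : r.2 ≤ 4) (m : ℕ) :
    ∃ r', bumpWord r (word x m) = some r' ∧ r'.2 ≤ 4 ∧ HasRun r' (fareyMap^[m] x) := by
  induction m generalizing r x with
  | zero => exact ⟨r, rfl, hr, h⟩
  | succ m ih =>
    obtain ⟨r₁, e₁, h₁, h₁'⟩ := h.bump hr
    obtain ⟨r₂, e₂, h₂, h₂'⟩ := ih h₁' h₁
    exact ⟨r₂, by simp [word, FareyDoubling.bumpWord, e₁, e₂], h₂, h₂'⟩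

/-- The list of states and runs describes a cascade of transducers that reads `x`, where no level
has a run of length five. -/
def Config : Run → List (State × Run) → ℝ → Prop
  | r, [], x => HasRun r x ∧ r.2 ≤ 4
  | r, (s, q) :: t, x => (HasRun r x ∧ r.2 ≤ 4) ∧ ∃ y, Related s x y ∧ Config q t y

theorem Config.feed {r : Run} {l : List (State × Run)} {x : ℝ} (h : Config r l x)
    (hx : PosIrrational x) (m : ℕ) :
    ∃ r' l', feed r l (word x m) = some (r', l') ∧ Config r' l' (fareyMap^[m] x) := by
  induction l generalizing r x m with
  | nil =>
    obtain ⟨r', e, h1, h2⟩ := h.1.bumpWord h.2 m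
    exact ⟨r', [], by simp [FareyDoubling.feed, e], h2, h1⟩
  | cons a t ih =>
    obtain ⟨s, q⟩ := a
    obtain ⟨⟨hr, hr'⟩, y, hy, hty⟩ := h
    obtain ⟨r', e, h1, h2⟩ := hr.bumpWord hr' m
    obtain ⟨e1, h3⟩ := related_run hy hx m
    obtain ⟨q', t', e2, h4⟩ := ih hty (hy.posIrrational hx) (run s (word x m)).2.length
    rw [← e1] at e2
    exact ⟨r', ((run s (word x m)).1, q') :: t', by simp [FareyDoubling.feed, e, e2],
      ⟨h2, h1⟩, _, h3, h4⟩

theorem config_of_tower {t : List State} {x : ℝ} (h : Tower NoLongRun t x) :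
    Config (true, 0) (t.map fun s => (s, (true, 0))) x := by
  have key : ∀ z, NoLongRun z → HasRun (true, 0) z ∧ (true, 0).2 ≤ 4 := fun z hz =>
    ⟨⟨z, hz, rfl, by simp⟩, by norm_num⟩
  induction t generalizing x with
  | nil => exact key x h
  | cons s t ih =>
    obtain ⟨h0, y, hy, hty⟩ := h
    exact ⟨key x h0, y, hy, ih hty⟩

theorem search_sound {n k : ℕ} {r : Run} {l : List (State × Run)} {x : ℝ}
    (hx : PosIrrational x) (h : Config r l (fareyMap^[k] x))
    (hs : search n (word x k) r l = true) : word (fareyMap^[3] x) 5 ∈ cycleFactors := by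
  induction n generalizing k r l with
  | zero => simp [search] at hs
  | succ n ih =>
    simp only [search, Bool.or_eq_true, Bool.and_eq_true, beq_iff_eq, length_word] at hs
    rcases hs with ⟨rfl, hs⟩ | hs
    · rw [word_add x 3 5, List.drop_left' (by simp)] at hs
      simpa using hs
    · obtain ⟨r', l', e, h'⟩ := h.feed (hx.iterate k) 1
      rw [← Function.iterate_add_apply, Nat.add_comm] at h'
      refine ih h' ?_
      rw [word_add]
      simp only [word] at e ⊢
      cases hb : letter (fareyMap^[k] x)
      · rw [hb] at e; simpa [e] using hs.2
      · rw [hb] at e; simpa [e] using hs.1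

theorem word_mem_cycleFactors {t : List State} {x : ℝ} (hx : PosIrrational x)
    (ht : t.length = 5) (hc : t.IsChain (compatible · ·)) (h : Tower NoLongRun t x) :
    word (fareyMap^[3] x) 5 ∈ cycleFactors :=
  search_sound (k := 0) hx (config_of_tower h) (search_towers t (ht ▸ mem_towers hc))

/-- If all the numbers `2 ^ k * x` eventually avoid runs of length five, then the Farey expansion of
`x` is eventually a shift of the periodic word. -/
theorem eventually_word_mem_cycleFactors {x : ℝ} (hx : PosIrrational x)
    (h : ∀ k : ℕ, ∃ n, NoLongRun (fareyMap^[n] (2 ^ k * x))) :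
    ∃ m, ∀ n ≥ m, word (fareyMap^[n] x) 5 ∈ cycleFactors := by
  have tower : ∀ j k : ℕ, Tower (fun z => ∃ n, NoLongRun (fareyMap^[n] z))
      (List.replicate j double) (2 ^ k * x) := by
    intro j
    induction j with
    | zero => exact h
    | succ j ih => exact fun k => ⟨h k, 2 ^ (k + 1) * x, by simp only [Related]; ring, ih (k + 1)⟩
  obtain ⟨m, hm⟩ := tower_eventually (t := List.replicate 5 double) hx (by simpa using tower 5 0)
  refine ⟨m + 3, fun n hn => ?_⟩
  obtain ⟨k, rfl⟩ := Nat.exists_eq_add_of_le hn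
  have := word_mem_cycleFactors (hx.iterate (m + k)) (by simp)
    (isChain_runTower (by simp [List.replicate, compatible]) _) (hm (m + k) (by omega))
  rw [← Function.iterate_add_apply] at this
  convert this using 3
  omega

/-! ### Partial quotients and runs -/

/-- The complete quotients of `x`: the numbers `[a_n; a_(n+1), …]`, for irrational `x`. -/
noncomputable def completeQuotient (x : ℝ) (n : ℕ) : ℝ := (fun y : ℝ => (Int.fract y)⁻¹)^[n] x

theorem completeQuotient_succ (x : ℝ) (n : ℕ) :
    completeQuotient x (n + 1) = (Int.fract (completeQuotient x n))⁻¹ :=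
  Function.iterate_succ_apply' _ _ _

theorem completeQuotient_add (x : ℝ) (m n : ℕ) :
    completeQuotient x (m + n) = completeQuotient (completeQuotient x n) m :=
  Function.iterate_add_apply _ _ _ _

theorem fract_pos_of_irrational {x : ℝ} (hx : Irrational x) : 0 < Int.fract x :=
  Int.fract_pos.2 (hx.ne_int _)

theorem irrational_fract {x : ℝ} (hx : Irrational x) : Irrational (Int.fract x) := by
  rw [Int.fract]
  exact hx.sub_intCast _

theorem irrational_completeQuotient {x : ℝ} (hx : Irrational x) (n : ℕ) :
    Irrational (completeQuotient x n) := by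
  induction n with
  | zero => exact hx
  | succ n ih =>
    rw [completeQuotient_succ]
    exact irrational_inv_iff.2 (irrational_fract ih)

theorem one_lt_inv_fract {x : ℝ} (hx : Irrational x) : 1 < (Int.fract x)⁻¹ :=
  (one_lt_inv₀ (fract_pos_of_irrational hx)).2 (Int.fract_lt_one x)

theorem partialQuotient_eq_floor {x : ℝ} (hx : Irrational x) (n : ℕ) :
    partialQuotient x n = ⌊completeQuotient x n⌋ := by
  cases n with
  | zero => exact GenContFract.of_h_eq_floor
  | succ n =>
    have key : (GenContFract.of x).s.get? n = some ⟨1, ⌊completeQuotient x (n + 1)⌋⟩ := by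
      induction n generalizing x with
      | zero => exact GenContFract.of_s_head (fract_pos_of_irrational hx).ne'
      | succ n ih =>
        rw [GenContFract.of_s_succ, completeQuotient_add x (n + 1) 1]
        exact ih (irrational_completeQuotient hx 1)
    simp [partialQuotient, GenContFract.partDen_eq_s_b key]

theorem iterate_fareyMap_of_le_floor {x : ℝ} (hx : PosIrrational x) {j : ℕ} (hj : (j : ℤ) ≤ ⌊x⌋) :
    fareyMap^[j] x = x - j := by
  induction j with
  | zero => simp
  | succ j ih =>
    have h : ((j + 1 : ℕ) : ℝ) < x :=
      lt_of_le_of_ne (by exact_mod_cast Int.le_floor.1 hj) (hx.2.ne_nat _).symm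
    push_cast at h
    rw [Function.iterate_succ_apply', ih (by push_cast at hj; omega),
      fareyMap_of_one_lt (by linarith)]
    push_cast; ring

theorem iterate_fareyMap_floor {x : ℝ} (hx : PosIrrational x) :
    fareyMap^[⌊x⌋.toNat] x = Int.fract x := by
  have h : (⌊x⌋.toNat : ℤ) = ⌊x⌋ := Int.toNat_of_nonneg (Int.floor_nonneg.2 hx.1.le)
  rw [iterate_fareyMap_of_le_floor hx h.le, Int.fract]
  congr 1
  exact_mod_cast h

theorem letter_iterate_of_lt_floor {x : ℝ} (hx : PosIrrational x) {j : ℕ} (hj : j < ⌊x⌋.toNat) :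
    letter (fareyMap^[j] x) = true := by
  have h : ((j + 1 : ℕ) : ℤ) ≤ ⌊x⌋ := by omega
  have h' : ((j + 1 : ℕ) : ℝ) < x :=
    lt_of_le_of_ne (by exact_mod_cast Int.le_floor.1 h) (hx.2.ne_nat _).symm
  push_cast at h'
  rw [iterate_fareyMap_of_le_floor hx (by omega)]
  exact letter_eq_true (by linarith)

/-- An irrational `x > 1` all of whose partial quotients are at most `4`. -/
structure BoundedQuotients (x : ℝ) : Prop where
  irrational : Irrational x
  one_lt : 1 < x
  floor_le : ∀ n, ⌊completeQuotient x n⌋ ≤ 4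

theorem BoundedQuotients.posIrrational {x : ℝ} (h : BoundedQuotients x) : PosIrrational x :=
  ⟨zero_lt_one.trans h.one_lt, h.irrational⟩

theorem BoundedQuotients.next {x : ℝ} (h : BoundedQuotients x) :
    BoundedQuotients (Int.fract x)⁻¹ :=
  ⟨irrational_completeQuotient h.irrational 1, one_lt_inv_fract h.irrational, fun n => by
    have := h.floor_le (n + 1)
    rwa [completeQuotient_add] at this⟩

theorem BoundedQuotients.toNat_floor_pos {x : ℝ} (h : BoundedQuotients x) : 0 < ⌊x⌋.toNat := by
  have : 1 ≤ ⌊x⌋ := Int.le_floor.2 (by exact_mod_cast h.one_lt.le)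
  omega

/-- The Farey orbit runs down each complete quotient by unit steps, alternately on it and on its
reciprocal. -/
theorem BoundedQuotients.exists_iterate {x : ℝ} (h : BoundedQuotients x) (n : ℕ) :
    ∃ y, BoundedQuotients y ∧ ∃ j < ⌊y⌋.toNat,
      fareyMap^[n] x = fareyMap^[j] y ∨ fareyMap^[n] x = (fareyMap^[j] y)⁻¹ := by
  induction n with
  | zero => exact ⟨x, h, 0, h.toNat_floor_pos, Or.inl rfl⟩
  | succ n ih =>
    obtain ⟨y, hy, j, hj, e⟩ := ih
    have e' : fareyMap^[n + 1] x = fareyMap^[j + 1] y ∨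
        fareyMap^[n + 1] x = (fareyMap^[j + 1] y)⁻¹ := by
      rw [Function.iterate_succ_apply', Function.iterate_succ_apply']
      refine e.imp (fun e => by rw [e]) (fun e => ?_)
      rw [e, fareyMap_inv (hy.posIrrational.iterate j)]
    rcases Nat.lt_or_ge (j + 1) ⌊y⌋.toNat with hlt | hge
    · exact ⟨y, hy, j + 1, hlt, e'⟩
    · refine ⟨_, hy.next, 0, hy.next.toNat_floor_pos, ?_⟩
      have hj' : j + 1 = ⌊y⌋.toNat := by omega
      rw [hj', iterate_fareyMap_floor hy.posIrrational] at e'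
      simpa using e'.symm

theorem BoundedQuotients.noLongRun {x : ℝ} (h : BoundedQuotients x) : NoLongRun x := by
  intro n
  -- The run through position `n` ends when the current complete quotient `y < 5` is used up.
  obtain ⟨y, hy, j, hj, e⟩ := h.exists_iterate n
  have hb : ⌊y⌋ ≤ 4 := hy.floor_le 0
  have h1 := letter_iterate_of_lt_floor hy.posIrrational hj
  have h2 : letter (fareyMap^[⌊y⌋.toNat] y) = false := by
    rw [iterate_fareyMap_floor hy.posIrrational]
    exact letter_eq_false (Int.fract_lt_one y)
  have h3 : fareyMap^[⌊y⌋.toNat] y = fareyMap^[⌊y⌋.toNat - j] (fareyMap^[j] y) := by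
    rw [← Function.iterate_add_apply]; congr 2; omega
  rw [h3] at h2
  refine ⟨⌊y⌋.toNat - j, by omega, ?_⟩
  rw [Nat.add_comm, Function.iterate_add_apply]
  have hp := hy.posIrrational.iterate j
  rcases e with e | e <;> rw [e]
  · rw [h1, h2]; decide
  · rw [iterate_fareyMap_inv hp, letter_inv hp, letter_inv (hp.iterate _), h1, h2]; decide

theorem noLongRun_inv {x : ℝ} (hx : PosIrrational x) (h : NoLongRun x) : NoLongRun x⁻¹ := by
  intro n
  obtain ⟨i, hi, hne⟩ := h n
  refine ⟨i, hi, ?_⟩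
  rw [iterate_fareyMap_inv hx, iterate_fareyMap_inv hx, letter_inv (hx.iterate _),
    letter_inv (hx.iterate _)]
  simpa using hne

theorem exists_iterate_eq_completeQuotient {x y : ℝ} (hx : Irrational x) (hy : PosIrrational y)
    (h : Int.fract y = Int.fract x) (n : ℕ) :
    ∃ m, fareyMap^[m] y = completeQuotient x (n + 1) ∨
      fareyMap^[m] y = (completeQuotient x (n + 1))⁻¹ := by
  induction n with
  | zero =>
    exact ⟨_, Or.inr (by rw [iterate_fareyMap_floor hy, h, completeQuotient_succ, inv_inv]; rfl)⟩
  | succ n ih =>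
    obtain ⟨m, hm⟩ := ih
    set z := completeQuotient x (n + 1) with hz
    have hpz : PosIrrational z := ⟨by
      rw [hz, completeQuotient_succ]
      exact inv_pos.2 (fract_pos_of_irrational (irrational_completeQuotient hx n)),
      irrational_completeQuotient hx _⟩
    refine ⟨⌊z⌋.toNat + m, ?_⟩
    rw [Function.iterate_add_apply, completeQuotient_succ, inv_inv, ← hz]
    rcases hm with hm | hm
    · right; rw [hm, iterate_fareyMap_floor hpz]
    · left; rw [hm, iterate_fareyMap_inv hpz, iterate_fareyMap_floor hpz]

/-- The number `x` may be changed by an integer, which is how negative numbers are brought into the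
domain of the Farey map. -/
theorem exists_noLongRun {x y : ℝ} (hx : Irrational x) (hy : PosIrrational y)
    (h : Int.fract y = Int.fract x) (hB : limsupPartialQuotients x < 5) :
    ∃ m, NoLongRun (fareyMap^[m] y) := by
  have hev := eventually_lt_of_limsup_lt hB
  obtain ⟨N, hN⟩ := eventually_atTop.1 hev
  have hb : ∀ n ≥ N, ⌊completeQuotient x n⌋ ≤ 4 := by
    intro n hn
    have h5 : ((partialQuotient x n : ℝ) : EReal) < ((5 : ℝ) : EReal) := hN n hn
    rw [EReal.coe_lt_coe_iff, partialQuotient_eq_floor hx] at h5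
    have : ⌊completeQuotient x n⌋ < 5 := by exact_mod_cast h5
    omega
  have hq : BoundedQuotients (completeQuotient x (N + 1)) :=
    ⟨irrational_completeQuotient hx _, by
      rw [completeQuotient_succ]; exact one_lt_inv_fract (irrational_completeQuotient hx N),
      fun n => by rw [← completeQuotient_add]; exact hb _ (by omega)⟩
  obtain ⟨m, hm | hm⟩ := exists_iterate_eq_completeQuotient hx hy h N
  · exact ⟨m, hm ▸ hq.noLongRun⟩
  · exact ⟨m, hm ▸ noLongRun_inv hq.posIrrational hq.noLongRun⟩

/-! ### Quadratic numbers of discriminant 17 -/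

/-- `x` is a root of an integral quadratic polynomial of discriminant `17`. -/
def IsRootDisc17 (x : ℝ) : Prop :=
  ∃ a b c : ℤ, b ^ 2 - 4 * a * c = 17 ∧ a * x ^ 2 + b * x + c = 0

theorem isRootDisc17_of_fareyMap {x : ℝ} (hx : PosIrrational x) (h : IsRootDisc17 (fareyMap x)) :
    IsRootDisc17 x := by
  obtain ⟨a, b, c, hd, hr⟩ := h
  rcases hx.lt_or_lt with h1 | h1
  · rw [fareyMap_of_one_lt h1] at hr
    refine ⟨a, b - 2 * a, a - b + c, by linear_combination hd, ?_⟩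
    push_cast
    linear_combination hr
  · rw [fareyMap_of_lt_one h1] at hr
    refine ⟨a - b + c, b - 2 * c, c, by linear_combination hd, ?_⟩
    have : 1 - x ≠ 0 := by linarith
    field_simp at hr
    push_cast
    linear_combination hr

theorem isRootDisc17_of_iterate {x : ℝ} (hx : PosIrrational x) {n : ℕ}
    (h : IsRootDisc17 (fareyMap^[n] x)) : IsRootDisc17 x := by
  induction n with
  | zero => exact h
  | succ n ih =>
    rw [Function.iterate_succ_apply'] at h
    exact ih (isRootDisc17_of_fareyMap (hx.iterate n) h)

theorem eq_zero_of_linear {x : ℝ} (hx : Irrational x) {u v : ℤ} (h : u * x + v = 0) :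
    u = 0 ∧ v = 0 := by
  have hu : u = 0 := by
    by_contra hu
    have hu' : (u : ℝ) ≠ 0 := by exact_mod_cast hu
    refine hx.ne_rat (-v / u : ℚ) ?_
    push_cast
    field_simp
    linarith
  subst hu
  refine ⟨rfl, ?_⟩
  simpa using h

/-- Let `a` be the leading coefficient for `x` and `a'` the one for `2 ^ k * x`. The two polynomials
for `x` are proportional, and comparing discriminants gives `a = ± 2 ^ k * a'`, so that `a` would be
divisible by every power of `2`. -/
theorem not_forall_isRootDisc17 {x : ℝ} (hx : Irrational x) :
    ¬ ∀ k : ℕ, IsRootDisc17 (2 ^ k * x) := by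
  intro H
  obtain ⟨a, b, c, hd, hr⟩ := H 0
  rw [pow_zero, one_mul] at hr
  have ha : a ≠ 0 := by
    rintro rfl
    obtain ⟨rfl, -⟩ := eq_zero_of_linear hx (u := b) (v := c) (by simpa using hr)
    norm_num at hd
  -- `k = |a|` is large enough, because `|a| < 2 ^ |a|`.
  obtain ⟨a', b', c', hd', hr'⟩ := H a.natAbs
  set q : ℤ := 2 ^ a.natAbs with hq
  have hq' : ((q : ℤ) : ℝ) = 2 ^ a.natAbs := by rw [hq]; push_cast; rfl
  rw [← hq'] at hr'
  obtain ⟨e1, e2⟩ := eq_zero_of_linear hx (u := a * (q * b') - a' * q ^ 2 * b)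
    (v := a * c' - a' * q ^ 2 * c) (by push_cast; linear_combination a * hr' - a' * q ^ 2 * hr)
  have hq0 : q ≠ 0 := by positivity
  have e1' : a * b' = a' * q * b := by
    apply mul_left_cancel₀ hq0; linear_combination e1
  have e3 : a ^ 2 = (q * a') ^ 2 := by
    have : a ^ 2 * 17 = (q * a') ^ 2 * 17 := by
      linear_combination (-a ^ 2) * hd' + (q * a') ^ 2 * hd + (a * b' + a' * q * b) * e1'
        - 4 * a * a' * e2
    linarith
  have hdvd : q ∣ a := by
    rcases sq_eq_sq_iff_eq_or_eq_neg.1 e3 with h | h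
    · exact ⟨a', h⟩
    · exact ⟨-a', by rw [h]; ring⟩
  have hle := Int.le_of_dvd (abs_pos.2 ha) ((dvd_abs _ _).2 hdvd)
  have hlt : (a.natAbs : ℤ) < q := by
    rw [hq]; exact_mod_cast Nat.lt_two_pow_self
  rw [Int.natCast_natAbs] at hlt
  omega

/-! ### Periodic expansions -/

/-- A factor of length five determines its position in the period, so overlapping factors advance by
one position at a time. -/
theorem exists_periodic_of_word_mem {x : ℝ} (h : ∀ n, word (fareyMap^[n] x) 5 ∈ cycleFactors) :
    ∃ j, ∀ n, word (fareyMap^[j + 10 * n] x) 10 = period := by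
  have hidx : ∀ n, ∃ p < 10, word (fareyMap^[n] x) 5 = cycleFactors.getD p [] := by
    intro n
    obtain ⟨p, hp, e⟩ := List.getElem_of_mem (h n)
    exact ⟨p, by simpa [cycleFactors] using hp, by rw [← e, List.getD_eq_getElem _ _ hp]⟩
  choose p hp hw using hidx
  have hnext : ∀ n, p (n + 1) = (p n + 1) % 10 := by
    intro n
    have hd : ∀ r < 10, ∀ s < 10,
        (cycleFactors.getD s []).take 4 = (cycleFactors.getD r []).drop 1 → s = (r + 1) % 10 := by
      decide
    refine hd _ (hp n) _ (hp (n + 1)) ?_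
    rw [← hw, ← hw, Function.iterate_succ_apply']
    rfl
  have hadd : ∀ n m, p (n + m) = (p n + m) % 10 := by
    intro n m
    induction m with
    | zero => exact (Nat.mod_eq_of_lt (hp n)).symm
    | succ m ih => rw [← Nat.add_assoc, hnext, ih]; omega
  have hword : ∀ n, p n = 0 → word (fareyMap^[n] x) 10 = period := by
    intro n hn
    have h5 : p (n + 5) = 5 := by rw [hadd, hn]
    have e := word_add (fareyMap^[n] x) 5 5
    rw [← Function.iterate_add_apply, Nat.add_comm 5 n, hw, hw, hn, h5] at e
    exact e
  refine ⟨10 - p 0, fun n => hword _ ?_⟩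
  have := hadd 0 (10 - p 0 + 10 * n)
  rw [Nat.zero_add] at this
  rw [this]
  have := hp 0
  omega

theorem eq_of_letter_true {x : ℝ} (h : letter x = true) : x = fareyMap x + 1 := by
  have : 1 < x := by simpa [letter] using h
  rw [fareyMap_of_one_lt this]; ring

theorem eq_of_letter_false {x : ℝ} (hx : PosIrrational x) (h : letter x = false) :
    x = fareyMap x / (1 + fareyMap x) := by
  have h1 : x < 1 := hx.lt_or_lt.resolve_left (by simpa [letter] using h)
  rw [fareyMap_of_lt_one h1]
  have : 1 - x ≠ 0 := by linarith
  have : 1 + x / (1 - x) = 1 / (1 - x) := by field_simp; ring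
  rw [this]; field_simp

/-- The Möbius map `(57 t + 16) / (32 t + 9)` is the composition of the inverse branches of
`fareyMap` along `period`. -/
theorem eq_of_word_period {x : ℝ} (hx : PosIrrational x) (h : word x 10 = period) :
    x = (57 * fareyMap^[10] x + 16) / (32 * fareyMap^[10] x + 9) := by
  simp only [word, period, List.cons.injEq, and_true] at h
  obtain ⟨h0, h1, h2, h3, h4, h5, h6, h7, h8, h9⟩ := h
  simp only [Function.iterate_succ_apply, Function.iterate_zero_apply]
  have p1 := hx.fareyMap
  have p2 := p1.fareyMap
  have p3 := p2.fareyMap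
  have p4 := p3.fareyMap
  have p5 := p4.fareyMap
  have p6 := p5.fareyMap
  have p7 := p6.fareyMap
  have p8 := p7.fareyMap
  have p9 := p8.fareyMap
  have p10 := p9.fareyMap.1
  have e0 := eq_of_letter_true h0
  have e1 := eq_of_letter_false p1 h1
  have e2 := eq_of_letter_true h2
  have e3 := eq_of_letter_true h3
  have e4 := eq_of_letter_true h4
  have e5 := eq_of_letter_false p5 h5
  have e6 := eq_of_letter_true h6
  have e7 := eq_of_letter_false p7 h7
  have e8 := eq_of_letter_false p8 h8
  have e9 := eq_of_letter_false p9 h9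
  generalize fareyMap (fareyMap (fareyMap (fareyMap (fareyMap (fareyMap (fareyMap (fareyMap
    (fareyMap (fareyMap x))))))))) = t at *
  rw [e9] at e8
  have f8 : t / (1 + t) / (1 + t / (1 + t)) = t / (1 + 2 * t) := by field_simp; ring
  rw [f8] at e8
  rw [e8] at e7
  have f7 : t / (1 + 2 * t) / (1 + t / (1 + 2 * t)) = t / (1 + 3 * t) := by field_simp; ring
  rw [f7] at e7
  rw [e7] at e6
  have f6 : t / (1 + 3 * t) + 1 = (1 + 4 * t) / (1 + 3 * t) := by field_simp; ring
  rw [f6] at e6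
  rw [e6] at e5
  have f5 : (1 + 4 * t) / (1 + 3 * t) / (1 + (1 + 4 * t) / (1 + 3 * t)) =
    (1 + 4 * t) / (2 + 7 * t) := by field_simp; ring
  rw [f5] at e5
  rw [e5] at e4
  rw [e4] at e3
  rw [e3] at e2
  have f2 : (1 + 4 * t) / (2 + 7 * t) + 1 + 1 + 1 = (7 + 25 * t) / (2 + 7 * t) := by
    field_simp; ring
  rw [f2] at e2
  rw [e2] at e1
  have f1 : (7 + 25 * t) / (2 + 7 * t) / (1 + (7 + 25 * t) / (2 + 7 * t)) =
    (7 + 25 * t) / (9 + 32 * t) := by field_simp; ring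
  rw [f1] at e1
  rw [e1] at e0
  rw [e0]
  field_simp; ring

/-- The form `2 x² - 3 x y - y²` is invariant under the matrix `[57, 16; 32, 9]`, so its value at a
point of the orbit is the value one period later divided by `(32 t + 9)² ≥ 81`. As the values are
bounded, they vanish. -/
theorem root_of_periodic {x : ℝ} (hx : PosIrrational x)
    (h : ∀ n, word (fareyMap^[10 * n] x) 10 = period) :
    2 * x ^ 2 - 3 * x - 1 = 0 := by
  have hpos : ∀ n, PosIrrational (fareyMap^[10 * n] x) := fun n => hx.iterate _
  have hshift : ∀ n, fareyMap^[10] (fareyMap^[10 * n] x) = fareyMap^[10 * (n + 1)] x := by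
    intro n
    rw [← Function.iterate_add_apply, Nat.mul_succ, Nat.add_comm]
  have bound : ∀ n, |2 * (fareyMap^[10 * n] x) ^ 2 - 3 * (fareyMap^[10 * n] x) - 1| ≤ 6 := by
    intro n
    have e := eq_of_word_period (hpos n) (h n)
    rw [hshift] at e
    have ht := (hpos (n + 1)).1
    have h2 : fareyMap^[10 * n] x < 2 := by
      rw [e, div_lt_iff₀ (by positivity)]; linarith
    have h0 := (hpos n).1
    rw [abs_le]
    constructor <;> nlinarith
  have contract : ∀ n, |2 * (fareyMap^[10 * n] x) ^ 2 - 3 * (fareyMap^[10 * n] x) - 1| ≤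
      |2 * (fareyMap^[10 * (n + 1)] x) ^ 2 - 3 * (fareyMap^[10 * (n + 1)] x) - 1| / 81 := by
    intro n
    have e := eq_of_word_period (hpos n) (h n)
    rw [hshift] at e
    have ht := (hpos (n + 1)).1
    generalize fareyMap^[10 * (n + 1)] x = t at *
    have : 2 * (fareyMap^[10 * n] x) ^ 2 - 3 * (fareyMap^[10 * n] x) - 1 =
        (2 * t ^ 2 - 3 * t - 1) / (32 * t + 9) ^ 2 := by
      rw [e]; field_simp; ring
    rw [this, abs_div, abs_of_pos (by positivity : 0 < (32 * t + 9) ^ 2)]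
    gcongr
    nlinarith
  have decay : ∀ n, |2 * x ^ 2 - 3 * x - 1| ≤
      |2 * (fareyMap^[10 * n] x) ^ 2 - 3 * (fareyMap^[10 * n] x) - 1| * (1 / 81) ^ n := by
    intro n
    induction n with
    | zero => simp
    | succ n ih =>
      refine ih.trans ((mul_le_mul_of_nonneg_right (contract n) (by positivity)).trans_eq ?_)
      rw [pow_succ]
      ring
  have lim : Tendsto (fun n : ℕ => 6 * (1 / 81 : ℝ) ^ n) atTop (nhds (6 * 0)) :=
    (tendsto_pow_atTop_nhds_zero_of_lt_one (by norm_num) (by norm_num)).const_mul 6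
  rw [mul_zero] at lim
  have := ge_of_tendsto' lim fun n => (decay n).trans (by gcongr; exact bound n)
  exact abs_nonpos_iff.1 this

theorem isRootDisc17_of_noLongRun {x : ℝ} (hx : PosIrrational x)
    (h : ∀ k : ℕ, ∃ n, NoLongRun (fareyMap^[n] (2 ^ k * x))) : IsRootDisc17 x := by
  obtain ⟨m, hm⟩ := eventually_word_mem_cycleFactors hx h
  obtain ⟨j, hj⟩ := exists_periodic_of_word_mem (x := fareyMap^[m] x) fun n => by
    rw [← Function.iterate_add_apply]; exact hm _ (by omega)
  refine isRootDisc17_of_iterate (n := j + m) hx ⟨2, -3, -1, by norm_num, ?_⟩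
  have := root_of_periodic (hx.iterate (j + m)) fun n => by
    have := hj n
    rw [← Function.iterate_add_apply] at this ⊢
    rwa [← Nat.add_assoc, Nat.add_comm (10 * n) j]
  push_cast
  linear_combination this

end FareyDoubling

open FareyDoubling in
theorem mainTheorem3 (α : ℝ) (hα : Irrational α) :
    5 ≤ ⨆ k : ℕ, limsupPartialQuotients (2 ^ k * α) := by
  by_contra! hlt
  have hB (k : ℕ) : limsupPartialQuotients (2 ^ k * α) < 5 :=
    (le_iSup (fun k : ℕ => limsupPartialQuotients (2 ^ k * α)) k).trans_lt hlt
  have irr {x : ℝ} (hx : Irrational x) (k : ℕ) : Irrational (2 ^ k * x) := by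
    simpa using hx.natCast_mul (m := 2 ^ k) (by positivity)
  have hβ := irrational_fract hα
  -- The Farey map needs positive numbers, so `α` is replaced by its fractional part.
  have hpos (k : ℕ) : PosIrrational (2 ^ k * Int.fract α) :=
    ⟨mul_pos (by positivity) (fract_pos_of_irrational hα), irr hβ k⟩
  have hgood (k : ℕ) : ∃ n, NoLongRun (fareyMap^[n] (2 ^ k * Int.fract α)) := by
    refine exists_noLongRun (irr hα k) (hpos k) ?_ (hB k)
    have : (2 : ℝ) ^ k * Int.fract α = 2 ^ k * α - ((2 ^ k * ⌊α⌋ : ℤ) : ℝ) := by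
      push_cast; rw [Int.fract]; ring
    rw [this, Int.fract_sub_intCast]
  refine not_forall_isRootDisc17 hβ fun k => isRootDisc17_of_noLongRun (hpos k) fun j => ?_
  rw [← mul_assoc, ← pow_add]
  exact hgood (j + k)
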